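/- Let $\varphi\in L^2(\mathbb R^2)$ be complex-valued with $\operatorname{supp}\varphi\subseteq[N_1,M_1]\times[N_2,M_2]$, and suppose that the shifts $\{\varphi(\cdot-k):k\in\mathbb Z^2\}$ are linearly independent in $L^2(\mathbb R^2)$. Suppose also that (i) the Sobolev smoothness $\nu_2(\varphi)=\sup\{s\in\mathbb R:\varphi\in H^s(\mathbb R^2)\}$ satisfies $\nu_2(\varphi)>1/2$; (ii) $\int_{\mathbb R^2}\varphi(x)\,dx\neq 0$. Let $V(\varphi,\mathbb Z^2)=\{\sum_{k\in\mathbb Z^2}c_k\varphi(\cdot-k):\sum_k|c_k|^2<\infty\}$ with convergence in $L^2(\mathbb R^2)$, let $a_1,b_1,a_2,b_2\in\mathbb R$, and let $W$ be the set of all $f\in V(\varphi,\mathbb Z^2)$ with $\operatorname{supp}f\subseteq[a_1,b_1]\times[a_2,b_2]$. Put $$E=\big([\lceil a_1-M_1\rceil,\lfloor b_1-N_1\rfloor]\times[\lceil a_2-M_2\rceil,\lfloor b_2-N_2\rfloor]\big)\cap\mathbb Z^2,\qquad E^+=\{x-y: x,y\in E,\ x\neq y\}.$$ Let $\mathcal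 N_{E^+}=\{y\in\mathbb R^2\setminus\{0\}: x\cdot y=0\text{ for some }0\ne x\in E^+\}$, and let $\mathrm{dv}_{\mathcal N_{E^+}}=\{y/\|y\|_2: y\in\mathcal N_{E^+}\}$ be its set of directions. For a direction $p=(\cos\theta,\sin\theta)$, let $\mathcal R_pf(t)=\int_{\mathbb R}f(t\cos\theta-s\sin\theta,\,t\sin\theta+s\cos\theta)\,ds$. Then $\mathrm{dv}_{\mathcal N_{E^+}}$ is finite, and for every $p\in\{(\cos\theta,\sin\theta):\theta\in[0,2\pi)\}\setminus\mathrm{dv}_{\mathcal N_{E^+}}$ the following hold. For every $f\in W$, the function $\mathcal R_pf$ agrees almost everywhere with a unique continuous function on $\mathbb R$; the samples of $\mathcal R_pf$ are the values of that continuous function. There is a set $X_p\subset\mathbb R$ with $\#X_p=\#E$, not depending on $f$, such that every $f\in W$ is uniquely determined by the samples of $\mathcal R_pf$ on $X_p$: if $f_1,f_2\in W$ and $\mathcal R_pf_1(x)=\mathcal R_pf_2(x)$ for all $x\in X_p$, then $f_1=f_2$ in $L^2(\mathbb R^2)$. -/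

import Mathlib

open MeasureTheory
open scoped ENNReal SchwartzMap

noncomputable section

namespace RadonSIS

/-- The Euclidean plane `ℝ²`. -/
abbrev Plane : Type := EuclideanSpace ℝ (Fin 2)

/-- The Hilbert space `L²(ℝ²)` of complex-valued functions. -/
abbrev L2Plane : Type := Lp ℂ 2 (volume : Measure Plane)

/-- The direction vector `(cos θ, sin θ)`. -/
def dirVec (θ : ℝ) : Plane := !₂[Real.cos θ, Real.sin θ]

/-- The set `{(cos θ, sin θ) : θ ∈ [0, 2π)}` of all direction vectors. -/
def allDirections : Set Plane := dirVec '' Set.Ico 0 (2 * Real.pi)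

/-- The closed rectangle `[a 0, b 0] × [a 1, b 1]`. -/
def rect (a b : Fin 2 → ℝ) : Set Plane := {x | ∀ i, x i ∈ Set.Icc (a i) (b i)}

/-- `f` vanishes almost everywhere off `S`; for a closed set `S` this says that the (essential)
support of the `L²` function `f` is contained in `S`. -/
def SuppIn (f : L2Plane) (S : Set Plane) : Prop :=
  ∀ᵐ x ∂(volume : Measure Plane), x ∉ S → f x = 0

/-- The point of `ℤ² ⊂ ℝ²` with integer coordinates `k`. -/
def latticePt (k : Fin 2 → ℤ) : Plane := !₂[(k 0 : ℝ), (k 1 : ℝ)]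

/-- The integer shift `φ(· - k)`, as an element of `L²(ℝ²)`. -/
def shift (φ : L2Plane) (k : Fin 2 → ℤ) : L2Plane :=
  Lp.compMeasurePreserving (fun x : Plane => x - latticePt k)
    (measurePreserving_sub_right volume (latticePt k)) φ

/-- The shift-invariant space `V(φ, ℤ²)`: all sums `∑ c k • φ(· - k)`, convergent in `L²(ℝ²)`, with
square-summable complex coefficients. -/
def sis (φ : L2Plane) : Set L2Plane :=
  {f | ∃ c : (Fin 2 → ℤ) → ℂ, Summable (fun k => ‖c k‖ ^ 2) ∧
    HasSum (fun k => c k • shift φ k) f}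

/-- The Sobolev smoothness `ν₂(f) = sup {s : f ∈ Hˢ(ℝ²)}`, an extended real number. -/
def sobolevSmoothness (f : L2Plane) : EReal :=
  sSup {s : EReal | ∃ r : ℝ, s = (r : EReal) ∧
    TemperedDistribution.MemSobolev r 2 (f : 𝓢'(Plane, ℂ))}

/-- The integral of `f` along the line `{t p + s p^⊥ : s ∈ ℝ}`, where `p^⊥ = (-p 1, p 0)`. For
`p = (cos θ, sin θ)` this is `∫ f(t cos θ - s sin θ, t sin θ + s cos θ) ds`. -/
def radon (p : Plane) (f : Plane → ℂ) (t : ℝ) : ℂ :=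
  ∫ s : ℝ, f !₂[t * p 0 - s * p 1, t * p 1 + s * p 0]

/-- The function `g` is the continuous version of the Radon transform of `f` in the direction `p`.
The Radon transform of an `L²` class is itself only a class modulo null sets, so its value at a
point, the Radon sample, is the value there of this continuous function. -/
def IsRadonTransform (p : Plane) (f : L2Plane) (g : ℝ → ℂ) : Prop :=
  Continuous g ∧ g =ᵐ[volume] radon p f

/-- The set of directions of the nonzero vectors of `S`. -/
def dv (S : Set Plane) : Set Plane :=
  {p | ∃ θ : ℝ, ∃ x ∈ S, x ≠ 0 ∧ x = ‖x‖ • dirVec θ ∧ p = dirVec θ}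

/-- The null set of `S`: the nonzero vectors that are orthogonal to some nonzero vector of `S`. -/
def nullSet (S : Set Plane) : Set Plane :=
  {y | y ≠ 0 ∧ ∃ x ∈ S, x ≠ 0 ∧ inner ℝ x y = 0}

/-- The finite set `E` of integer points in `∏ i, [⌈a i - M i⌉, ⌊b i - N i⌋]`. -/
def indexSet (a b N M : Fin 2 → ℝ) : Finset (Fin 2 → ℤ) :=
  Finset.Icc (fun i => ⌈a i - M i⌉) (fun i => ⌊b i - N i⌋)

/-- The set `E⁺` of differences of distinct points of `E`; it is empty when `E` has at most one
point. -/
def diffSet (E : Finset (Fin 2 → ℤ)) : Set Plane :=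
  {z | ∃ k ∈ E, ∃ l ∈ E, k ≠ l ∧ z = latticePt k - latticePt l}

/-- The class of functions to be recovered: the members of `V(φ, ℤ²)` supported in the rectangle
`[a 0, b 0] × [a 1, b 1]`. -/
def targets (φ : L2Plane) (a b : Fin 2 → ℝ) : Set L2Plane :=
  {f | f ∈ sis φ ∧ SuppIn f (rect a b)}

end RadonSIS

end

namespace RadonSIS

open FourierTransform Filter Topology
open scoped ContDiff

/-! Uniqueness. If the Radon transform of f in direction p vanishes, the Fourier slice theorem
(`fourier_radon`) makes the Fourier transform of f vanish on the line ℝp. Write f = ∑ c_k u(· - k),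
with u a representative of φ. The c_k are not known to be supported in E, but for almost every x the
samples f(x + k) with x ∈ [N, M] are, because f vanishes off its rectangle. Commutativity of
convolution (`finsum_mul_shiftSeries`) gives ∑ u(x + k) f(· - k) = ∑_{k ∈ E} f(x + k) u(· - k). On
ℝp the transform of the left side is 0, while that of u is nonzero near 0 because ∫ φ ≠ 0. Hence ∑
f(x + k) exp(-2πiσ k·p) vanishes for small σ ≥ 0. Off the exceptional directions the numbers k·p are
distinct, so a Vandermonde argument (`eq_zero_of_sum_fourierChar`) kills all samples, and f = 0
(`shiftSeries_ae_eq_zero`).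

Continuity. A target is a smooth cutoff of a finite combination of shifts of φ ∈ Hʳ, r > 1/2. Its
transform is integrable on ℝp by Cauchy–Schwarz, and Fourier inversion yields the continuous version
(`exists_continuous_radon`).

Sampling. Evaluations of the Radon transform are linear functionals that jointly separate a space of
dimension at most #E, so some #E of them already separate it (`exists_finset_separating`). -/

/-! ### Plane geometry and exceptional directions. -/

lemma inner_plane (x y : Plane) : inner ℝ x y = x 0 * y 0 + x 1 * y 1 := by
  simp [PiLp.inner_apply, Fin.sum_univ_two, mul_comm]

lemma norm_sq_plane (x : Plane) : ‖x‖ ^ 2 = x 0 ^ 2 + x 1 ^ 2 := by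
  simp [EuclideanSpace.norm_sq_eq, Fin.sum_univ_two]

lemma plane_ext {x y : Plane} (h0 : x 0 = y 0) (h1 : x 1 = y 1) : x = y := by
  ext i; fin_cases i <;> assumption

lemma dirVec_sq (θ : ℝ) : dirVec θ 0 ^ 2 + dirVec θ 1 ^ 2 = 1 := by
  simp [dirVec]

/-- Rotation by a right angle. -/
def perp (x : Plane) : Plane := !₂[-x 1, x 0]

/-- The directions of the vectors orthogonal to one of finitely many vectors form a finite set. -/
lemma finite_dv_nullSet {S : Set Plane} (hS : S.Finite) : (dv (nullSet S)).Finite := by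
  refine ((hS.image fun x => ‖x‖⁻¹ • perp x).union
    (hS.image fun x => -(‖x‖⁻¹ • perp x))).subset ?_
  rintro p ⟨θ, y, ⟨hy0, x, hxS, hx0, hxy⟩, -, hy, rfl⟩
  have hyn : ‖y‖ ≠ 0 := norm_ne_zero_iff.2 hy0
  have hxn : ‖x‖ ≠ 0 := norm_ne_zero_iff.2 hx0
  set d := dirVec θ with hd
  have hd1 : d 0 ^ 2 + d 1 ^ 2 = 1 := dirVec_sq θ
  have horth : x 0 * d 0 + x 1 * d 1 = 0 := by
    rw [hy, inner_smul_right, inner_plane] at hxy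
    exact (mul_eq_zero.1 hxy).resolve_left hyn
  have hx2 := norm_sq_plane x
  -- Lagrange's identity: as `x` is orthogonal to the unit vector `d`, their cross product is
  -- `±‖x‖`. The sign decides which of `±perp x / ‖x‖` equals `d`.
  have hw : (x 0 * d 1 - x 1 * d 0) ^ 2 = ‖x‖ ^ 2 := by
    rw [hx2]
    linear_combination (x 0 ^ 2 + x 1 ^ 2) * hd1 - (x 0 * d 0 + x 1 * d 1) * horth
  have e0 : (x 0 * d 1 - x 1 * d 0) * (-x 1) = ‖x‖ ^ 2 * d 0 := by
    rw [hx2]; linear_combination (-x 0) * horth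
  have e1 : (x 0 * d 1 - x 1 * d 0) * x 0 = ‖x‖ ^ 2 * d 1 := by
    rw [hx2]; linear_combination (-x 1) * horth
  rcases sq_eq_sq_iff_eq_or_eq_neg.1 hw with h | h <;> rw [h] at e0 e1
  · left
    refine ⟨x, hxS, plane_ext ?_ ?_⟩ <;> simp [perp] <;> field_simp <;>
      apply mul_left_cancel₀ hxn <;> linarith
  · right
    refine ⟨x, hxS, plane_ext ?_ ?_⟩ <;> simp [perp] <;> field_simp <;>
      apply mul_left_cancel₀ hxn <;> linarith

lemma finite_diffSet (E : Finset (Fin 2 → ℤ)) : (diffSet E).Finite := by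
  refine ((E ×ˢ E).finite_toSet.image
    fun q : (Fin 2 → ℤ) × (Fin 2 → ℤ) => latticePt q.1 - latticePt q.2).subset ?_
  rintro z ⟨k, hk, l, hl, -, rfl⟩
  exact ⟨(k, l), by simp [hk, hl], rfl⟩

lemma latticePt_injective : Function.Injective latticePt := by
  intro k l h
  have h0 := congrArg (fun x : Plane => x 0) h
  have h1 := congrArg (fun x : Plane => x 1) h
  simp [latticePt] at h0 h1
  ext i; fin_cases i <;> assumption

lemma latticePt_apply (k : Fin 2 → ℤ) (i : Fin 2) : latticePt k i = k i := by
  fin_cases i <;> simp [latticePt]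

lemma latticePt_add (k l : Fin 2 → ℤ) : latticePt (k + l) = latticePt k + latticePt l := by
  ext i; simp [latticePt_apply]

lemma latticePt_neg (k : Fin 2 → ℤ) : latticePt (-k) = -latticePt k := by
  ext i; simp [latticePt_apply]

lemma sq_add_sq_of_mem_allDirections {p : Plane} (hp : p ∈ allDirections) :
    p 0 ^ 2 + p 1 ^ 2 = 1 := by
  obtain ⟨θ, -, rfl⟩ := hp
  exact dirVec_sq θ

/-- Off the exceptional directions, the points of `E` have distinct projections. -/
lemma injOn_inner_of_notMem_dv {E : Finset (Fin 2 → ℤ)} {p : Plane}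
    (hp : p ∈ allDirections \ dv (nullSet (diffSet E))) :
    Set.InjOn (fun k => inner ℝ (latticePt k) p) E := by
  obtain ⟨⟨θ, hθ, rfl⟩, hnot⟩ := hp
  intro k hk l hl hkl
  by_contra hne
  have hn : ‖dirVec θ‖ = 1 := by
    have := norm_sq_plane (dirVec θ)
    rw [dirVec_sq] at this
    nlinarith [norm_nonneg (dirVec θ)]
  have h0 : dirVec θ ≠ 0 := norm_ne_zero_iff.1 (by rw [hn]; exact one_ne_zero)
  refine hnot ⟨θ, dirVec θ, ⟨h0, latticePt k - latticePt l, ⟨k, hk, l, hl, hne, rfl⟩, ?_, ?_⟩,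
    h0, by rw [hn, one_smul], rfl⟩
  · exact sub_ne_zero.2 fun h => hne (latticePt_injective h)
  · rw [inner_sub_left]; exact sub_eq_zero.2 hkl

/-! ### Rotated coordinates and the Fourier slice theorem. -/

/-- The point `t p + s p^⊥`. -/
def linePt (p : Plane) (z : ℝ × ℝ) : Plane := !₂[z.1 * p 0 - z.2 * p 1, z.1 * p 1 + z.2 * p 0]

/-- In these coordinates the Radon transform is a partial integral, so Fubini applies to it. -/
lemma measurePreserving_linePt {p : Plane} (hp : p 0 ^ 2 + p 1 ^ 2 = 1) :
    MeasurePreserving (linePt p) volume volume := by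
  let R : Plane →ₗᵢ[ℝ] Plane :=
    { toFun := fun x => !₂[x 0 * p 0 - x 1 * p 1, x 0 * p 1 + x 1 * p 0]
      map_add' := fun x y => by apply plane_ext <;> simp <;> ring
      map_smul' := fun c x => by apply plane_ext <;> simp <;> ring
      norm_map' := fun x => by
        have h : ‖(!₂[x 0 * p 0 - x 1 * p 1, x 0 * p 1 + x 1 * p 0] : Plane)‖ ^ 2 = ‖x‖ ^ 2 := by
          rw [norm_sq_plane, norm_sq_plane]; simp
          linear_combination (x 0 ^ 2 + x 1 ^ 2) * hp
        exact (sq_eq_sq₀ (norm_nonneg _) (norm_nonneg _)).1 h }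
  have h1 := (R.toLinearIsometryEquiv rfl).measurePreserving
  have h2 := PiLp.volume_preserving_toLp (Fin 2)
  have h3 := (volume_preserving_finTwoArrow ℝ).symm
  have h := (h1.comp h2).comp h3
  have e : linePt p = (R.toLinearIsometryEquiv rfl ∘ WithLp.toLp 2) ∘
      (MeasurableEquiv.finTwoArrow (α := ℝ)).symm := rfl
  rw [e]
  exact h

lemma inner_linePt {p : Plane} (hp : p 0 ^ 2 + p 1 ^ 2 = 1) (z : ℝ × ℝ) :
    inner ℝ (linePt p z) p = z.1 := by
  rw [inner_plane]; simp [linePt]; linear_combination z.1 * hp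

lemma inner_linePt_perp {p : Plane} (hp : p 0 ^ 2 + p 1 ^ 2 = 1) (z : ℝ × ℝ) :
    inner ℝ (linePt p z) (perp p) = z.2 := by
  rw [inner_plane]; simp [linePt, perp]; linear_combination z.2 * hp

lemma norm_sq_eq_inner {p : Plane} (hp : p 0 ^ 2 + p 1 ^ 2 = 1) (x : Plane) :
    ‖x‖ ^ 2 = inner ℝ x p ^ 2 + inner ℝ x (perp p) ^ 2 := by
  rw [inner_plane, inner_plane, norm_sq_plane]; simp [perp]
  linear_combination -(x 0 ^ 2 + x 1 ^ 2) * hp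

/-- Almost everywhere equal functions have almost everywhere equal Radon transforms. -/
lemma radon_congr_ae {p : Plane} (hp : p 0 ^ 2 + p 1 ^ 2 = 1) {f g : Plane → ℂ}
    (h : f =ᵐ[volume] g) : radon p f =ᵐ[volume] radon p g := by
  have h1 := (measurePreserving_linePt hp).quasiMeasurePreserving.ae h
  rw [Measure.volume_eq_prod] at h1
  filter_upwards [Measure.ae_ae_of_ae_prod h1] with t ht
  exact integral_congr_ae ht

lemma integrable_comp_linePt {p : Plane} (hp : p 0 ^ 2 + p 1 ^ 2 = 1) {f : Plane → ℂ}
    (hf : Integrable f) : Integrable (fun z => f (linePt p z)) (volume.prod volume) :=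
  (measurePreserving_linePt hp).integrable_comp_of_integrable hf

lemma radon_add {p : Plane} (hp : p 0 ^ 2 + p 1 ^ 2 = 1) {f g : Plane → ℂ}
    (hf : Integrable f) (hg : Integrable g) :
    radon p (fun x => f x + g x) =ᵐ[volume] fun t => radon p f t + radon p g t := by
  filter_upwards [(integrable_comp_linePt hp hf).prod_right_ae,
    (integrable_comp_linePt hp hg).prod_right_ae] with t h1 h2
  exact integral_add h1 h2

lemma radon_const_mul (p : Plane) (c : ℂ) (f : Plane → ℂ) (t : ℝ) :
    radon p (fun x => c * f x) t = c * radon p f t :=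
  integral_const_mul c _

lemma integrable_radon {p : Plane} (hp : p 0 ^ 2 + p 1 ^ 2 = 1) {f : Plane → ℂ}
    (hf : Integrable f) : Integrable (radon p f) :=
  (integrable_comp_linePt hp hf).integral_prod_left

/-- The Fourier slice theorem. -/
lemma fourier_radon {p : Plane} (hp : p 0 ^ 2 + p 1 ^ 2 = 1) {f : Plane → ℂ}
    (hf : Integrable f) (σ : ℝ) : 𝓕 (radon p f) σ = 𝓕 f (σ • p) := by
  have hF : Integrable (fun v : Plane => 𝐞 (-inner ℝ v (σ • p)) • f v) :=
    (Real.fourierIntegral_convergent_iff (σ • p)).2 hf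
  have hm := measurePreserving_linePt hp
  have h1 := integrable_comp_linePt (f := fun v : Plane => 𝐞 (-inner ℝ v (σ • p)) • f v) hp hF
  rw [Real.fourier_eq, Real.fourier_eq, ← hm.map_eq, integral_map hm.measurable.aemeasurable
    (by rw [hm.map_eq]; exact hF.aestronglyMeasurable), Measure.volume_eq_prod,
    integral_prod _ h1]
  refine integral_congr_ae (ae_of_all _ fun t => ?_)
  simp only [inner_smul_right, inner_linePt hp, radon]
  rw [Circle.smul_def, ← integral_smul]
  refine integral_congr_ae (ae_of_all _ fun s => ?_)
  simp [linePt, Circle.smul_def]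

/-! ### Duality and inversion for the Fourier transform. -/

section Fourier

variable {V : Type*} [NormedAddCommGroup V] [InnerProductSpace ℝ V] [FiniteDimensional ℝ V]
  [MeasurableSpace V] [BorelSpace V]

/-- The Fourier transform is self-adjoint on integrable functions. -/
lemma integral_fourier_mul {f g : V → ℂ} (hf : Integrable f) (hg : Integrable g) :
    ∫ ξ, 𝓕 f ξ * g ξ = ∫ x, f x * 𝓕 g x := by
  have h := VectorFourier.integral_fourierIntegral_smul_eq_flip (L := innerₗ V) (μ := volume)
    (ν := volume) Real.continuous_fourierChar continuous_inner hf hg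
  rw [flip_innerₗ] at h
  exact h

lemma continuous_fourier {f : V → ℂ} (hf : Integrable f) : Continuous (𝓕 f) :=
  VectorFourier.fourierIntegral_continuous (L := innerₗ V) Real.continuous_fourierChar
    continuous_inner hf

/-- The inverse Fourier transform is self-adjoint on integrable functions. -/
lemma integral_fourierInv_mul {f g : V → ℂ} (hf : Integrable f) (hg : Integrable g) :
    ∫ ξ, 𝓕⁻ f ξ * g ξ = ∫ x, f x * 𝓕⁻ g x := by
  have h := integral_fourier_mul (f := fun x => f (-x)) hf.comp_neg hg
  rw [← Real.fourierInv_eq_fourier_comp_neg] at h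
  rw [h, ← integral_neg_eq_self]
  simp [Real.fourierInv_eq_fourier_neg]

/-- Fourier inversion almost everywhere, for an integrable function with integrable transform. -/
lemma fourierInv_fourier_ae_eq {h : V → ℂ} (hi : Integrable h) (hF : Integrable (𝓕 h)) :
    𝓕⁻ (𝓕 h) =ᵐ[volume] h := by
  have hc : Continuous (𝓕⁻ (𝓕 h)) := by
    rw [Real.fourierInv_eq_fourier_comp_neg]
    exact continuous_fourier hF.comp_neg
  refine ae_eq_of_integral_contDiff_smul_eq hc.locallyIntegrable hi.locallyIntegrable ?_
  intro g hg hgs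
  have hgs' : HasCompactSupport (fun x => (g x : ℂ)) := hgs.comp_left Complex.ofReal_zero
  let G : 𝓢(V, ℂ) := hgs'.toSchwartzMap (Complex.ofRealCLM.contDiff.comp hg)
  have hG : ∀ x, G x = g x := fun x => rfl
  have e1 : ∫ x, G x * 𝓕⁻ (𝓕 h) x = ∫ x, 𝓕⁻ (G : V → ℂ) x * 𝓕 h x :=
    (integral_fourierInv_mul G.integrable hF).symm
  have e2 : 𝓕⁻ (G : V → ℂ) = (𝓕⁻ G : 𝓢(V, ℂ)) := (SchwartzMap.fourierInv_coe G).symm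
  have e3 : 𝓕 ((𝓕⁻ G : 𝓢(V, ℂ)) : V → ℂ) = G := by
    rw [← SchwartzMap.fourier_coe, fourier_fourierInv_eq]
  have e4 := integral_fourier_mul (𝓕⁻ G).integrable hi
  rw [e3] at e4
  simp only [Complex.real_smul, ← hG]
  rw [e1, e2, e4]

end Fourier

/-! ### Sobolev weights and continuity of the Radon transform. -/

/-- Membership in a Sobolev space gives a weighted `L²` bound on the Fourier integral. -/
lemma memLp_weight_fourier {φ : L2Plane} {r : ℝ}
    (h : TemperedDistribution.MemSobolev r 2 (φ : 𝓢'(Plane, ℂ)))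
    (hi : Integrable (φ : Plane → ℂ)) :
    MemLp (fun ξ : Plane => (((1 + ‖ξ‖ ^ 2) ^ (r / 2) : ℝ) : ℂ) * 𝓕 (φ : Plane → ℂ) ξ) 2 := by
  obtain ⟨u, hu⟩ := TemperedDistribution.memSobolev_iff_exists_smulLeftCLM_fourier.1 h
  have hw : Continuous fun ξ : Plane => (((1 + ‖ξ‖ ^ 2) ^ (r / 2) : ℝ) : ℂ) :=
    Complex.continuous_ofReal.comp ((by fun_prop : Continuous fun ξ : Plane =>
      1 + ‖ξ‖ ^ 2).rpow_const fun ξ => Or.inl (by positivity))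
  have hwt : Function.HasTemperateGrowth
      fun ξ : Plane => (((1 + ‖ξ‖ ^ 2) ^ (r / 2) : ℝ) : ℂ) := by fun_prop
  refine (memLp_congr_ae ?_).1 (Lp.memLp u)
  symm
  refine ae_eq_of_integral_contDiff_smul_eq
    (hw.mul (continuous_fourier hi)).locallyIntegrable
    ((Lp.memLp u).locallyIntegrable (by norm_num)) ?_
  intro g hg hgs
  have hgs' : HasCompactSupport (fun x => (g x : ℂ)) := hgs.comp_left Complex.ofReal_zero
  let G : 𝓢(Plane, ℂ) := hgs'.toSchwartzMap (Complex.ofRealCLM.contDiff.comp hg)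
  have hG : ∀ x, G x = g x := fun x => rfl
  have e := DFunLike.congr_fun hu G
  rw [TemperedDistribution.smulLeftCLM_apply_apply, TemperedDistribution.fourier_apply,
    Lp.toTemperedDistribution_apply, Lp.toTemperedDistribution_apply] at e
  simp only [smul_eq_mul] at e
  rw [SchwartzMap.fourier_coe, integral_fourier_mul (SchwartzMap.integrable _) hi] at e
  simp only [Complex.real_smul, ← hG]
  rw [← e]
  refine integral_congr_ae (ae_of_all _ fun x => ?_)
  simp only [SchwartzMap.smulLeftCLM_apply_apply hwt, smul_eq_mul]
  ring

/-- The reciprocal of the Sobolev weight, damped in one direction, is square integrable. -/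
lemma memLp_damped_weight {p : Plane} (hp : p 0 ^ 2 + p 1 ^ 2 = 1) {r : ℝ} (hr : 1 / 2 < r) :
    MemLp (fun η : Plane => (1 + ‖η‖ ^ 2) ^ (-r / 2) * (1 + inner ℝ η (perp p) ^ 2)⁻¹) 2 := by
  have hc : Continuous fun η : Plane =>
      (1 + ‖η‖ ^ 2) ^ (-r / 2) * (1 + inner ℝ η (perp p) ^ 2)⁻¹ := by
    refine ((by fun_prop : Continuous fun ξ : Plane =>
      1 + ‖ξ‖ ^ 2).rpow_const fun ξ => Or.inl (by positivity)).mul (Continuous.inv₀ (by fun_prop)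
      fun ξ => by positivity)
  rw [memLp_two_iff_integrable_sq hc.aestronglyMeasurable]
  have hm := measurePreserving_linePt hp
  have hc2 : Continuous fun η : Plane =>
      ((1 + ‖η‖ ^ 2) ^ (-r / 2) * (1 + inner ℝ η (perp p) ^ 2)⁻¹) ^ 2 := hc.pow 2
  rw [← hm.map_eq, integrable_map_measure hc2.aestronglyMeasurable hm.measurable.aemeasurable]
  -- For η = t p + s p^⊥ the squared function is at most (1 + t²)^(-r) (1 + s²)⁻¹. The first factor
  -- is integrable exactly because 2r > 1.
  have h1 : Integrable (fun t : ℝ => (1 + ‖t‖ ^ 2) ^ (-(2 * r) / 2)) :=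
    integrable_rpow_neg_one_add_norm_sq (by simp; linarith)
  have h2 : Integrable (fun s : ℝ => (1 + s ^ 2)⁻¹) := integrable_inv_one_add_sq
  refine (h1.mul_prod h2).mono' ?_ (ae_of_all _ fun z => ?_)
  · exact hc2.aestronglyMeasurable.comp_measurable hm.measurable
  · simp only [Function.comp_apply]
    rw [norm_sq_eq_inner hp, inner_linePt hp, inner_linePt_perp hp, Real.norm_of_nonneg
      (by positivity), mul_pow, ← Real.rpow_natCast, ← Real.rpow_mul (by positivity),
      Real.norm_eq_abs, sq_abs]
    have ha : (-r / 2 * (2 : ℕ) : ℝ) = -(2 * r) / 2 := by push_cast; ring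
    rw [ha]
    refine mul_le_mul (Real.rpow_le_rpow_of_nonpos (by positivity) (by nlinarith [sq_nonneg z.2])
      (by linarith)) ?_ (by positivity) (by positivity)
    refine pow_le_of_le_one (by positivity) ?_ two_ne_zero
    exact inv_le_one_of_one_le₀ (by nlinarith [sq_nonneg z.2])

/-- Fourth-order decay leaves one factor (1 + (·)²)⁻¹ for each of the two coordinates along `p` and
`perp p`. -/
lemma schwartz_decay (ψ : 𝓢(Plane, ℂ)) : ∃ C : ℝ, ∀ x, ‖ψ x‖ ≤ C * ((1 + ‖x‖ ^ 2) ^ 2)⁻¹ := by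
  refine ⟨2 ^ 4 * ((Finset.Iic (4, 0)).sup fun m : ℕ × ℕ =>
    SchwartzMap.seminorm ℂ m.1 m.2) ψ, fun x => ?_⟩
  have h := SchwartzMap.one_add_le_sup_seminorm_apply (𝕜 := ℂ) (m := (4, 0)) le_rfl le_rfl ψ x
  rw [norm_iteratedFDeriv_zero] at h
  rw [← div_eq_mul_inv, le_div_iff₀ (by positivity), mul_comm]
  refine le_trans (mul_le_mul_of_nonneg_right ?_ (norm_nonneg _)) h
  have := norm_nonneg x
  calc (1 + ‖x‖ ^ 2) ^ 2 ≤ ((1 + ‖x‖) ^ 2) ^ 2 := by gcongr; nlinarith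
    _ = _ := by ring

/-- A weighted `L²` function, smoothed by a Schwartz function, is integrable along a line. -/
lemma integrable_line_of_memLp {p : Plane} (hp : p 0 ^ 2 + p 1 ^ 2 = 1) {r : ℝ} (hr : 1 / 2 < r)
    {v : Plane → ℂ} (hv : Continuous v)
    (hvw : MemLp (fun ξ : Plane => (((1 + ‖ξ‖ ^ 2) ^ (r / 2) : ℝ) : ℂ) * v ξ) 2)
    (ψ : 𝓢(Plane, ℂ)) : Integrable fun σ : ℝ => ∫ η, v η * ψ (η - σ • p) := by
  obtain ⟨C, hC⟩ := schwartz_decay ψ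
  have hC0 : 0 ≤ C := by
    have := (norm_nonneg _).trans (hC 0)
    simpa using this
  have hpp : inner ℝ p p = (1 : ℝ) := by rw [inner_plane]; linarith
  have hpq : inner ℝ p (perp p) = (0 : ℝ) := by rw [inner_plane]; simp [perp]; ring
  -- Cauchy–Schwarz: the weighted `v` against the damped reciprocal weight.
  have hdom : Integrable fun η : Plane => ‖v η‖ * (1 + inner ℝ η (perp p) ^ 2)⁻¹ := by
    refine (hvw.norm.integrable_mul (memLp_damped_weight hp hr)).congr (ae_of_all _ fun η => ?_)
    simp only [Pi.mul_apply, norm_mul, Complex.norm_real]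
    rw [Real.norm_of_nonneg (by positivity), neg_div, Real.rpow_neg (by positivity)]
    have : (0 : ℝ) < (1 + ‖η‖ ^ 2) ^ (r / 2) := by positivity
    field_simp
  -- This majorant comes from (1 + A² + B²)² ≥ (1 + A²)(1 + B²). Integrating out σ gives the
  -- constant Cπ and leaves `hdom`.
  have hint : Integrable (fun z : Plane × ℝ => (‖v z.1‖ * (1 + inner ℝ z.1 (perp p) ^ 2)⁻¹) *
      (C * (1 + (inner ℝ z.1 p - z.2) ^ 2)⁻¹)) (volume.prod volume) := by
    rw [integrable_prod_iff]
    · constructor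
      · exact ae_of_all _ fun η =>
          ((integrable_inv_one_add_sq.comp_sub_left (inner ℝ η p)).const_mul C).const_mul
            (‖v η‖ * (1 + inner ℝ η (perp p) ^ 2)⁻¹)
      · refine (hdom.mul_const (C * Real.pi)).congr (ae_of_all _ fun η => ?_)
        have : ∀ σ : ℝ, ‖(‖v η‖ * (1 + inner ℝ η (perp p) ^ 2)⁻¹) *
            (C * (1 + (inner ℝ η p - σ) ^ 2)⁻¹)‖ = (‖v η‖ * (1 + inner ℝ η (perp p) ^ 2)⁻¹) *
            (C * (1 + (inner ℝ η p - σ) ^ 2)⁻¹) := fun σ =>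
          Real.norm_of_nonneg (by positivity)
        simp only [this]
        rw [integral_const_mul, integral_const_mul,
          integral_sub_left_eq_self (fun σ : ℝ => (1 + σ ^ 2)⁻¹) volume (inner ℝ η p),
          integral_univ_inv_one_add_sq]
    · refine Continuous.aestronglyMeasurable ?_
      refine ((hv.comp continuous_fst).norm.mul (Continuous.inv₀ (by fun_prop) fun z => ?_)).mul
        (continuous_const.mul (Continuous.inv₀ (by fun_prop) fun z => ?_)) <;> positivity
  refine Integrable.integral_prod_right (f := fun z : Plane × ℝ => v z.1 * ψ (z.1 - z.2 • p))
    (hint.mono' ?_ (ae_of_all _ fun z => ?_))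
  · have := ψ.continuous
    exact Continuous.aestronglyMeasurable (by fun_prop)
  · rw [norm_mul, mul_assoc]
    refine mul_le_mul_of_nonneg_left ((hC _).trans ?_) (norm_nonneg _)
    rw [mul_left_comm]
    refine mul_le_mul_of_nonneg_left ?_ hC0
    rw [← mul_inv, norm_sq_eq_inner hp, inner_sub_left, inner_sub_left, real_inner_smul_left,
      real_inner_smul_left, hpp, hpq, mul_one, mul_zero, sub_zero]
    refine inv_anti₀ (by positivity) ?_
    nlinarith [sq_nonneg (inner ℝ z.1 (perp p)), sq_nonneg (inner ℝ z.1 p - z.2),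
      mul_nonneg (sq_nonneg (inner ℝ z.1 (perp p))) (sq_nonneg (inner ℝ z.1 p - z.2))]

/-- The Radon transform of a localized `Hʳ` function has a continuous version if `r > 1/2`. -/
lemma exists_continuous_radon {p : Plane} (hp : p 0 ^ 2 + p 1 ^ 2 = 1) {r : ℝ} (hr : 1 / 2 < r)
    {g : Plane → ℂ} (hg : Integrable g)
    (hgw : MemLp (fun ξ : Plane => (((1 + ‖ξ‖ ^ 2) ^ (r / 2) : ℝ) : ℂ) * 𝓕 g ξ) 2)
    {χ : Plane → ℂ} (hχ : ContDiff ℝ ∞ χ) (hχs : HasCompactSupport χ) :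
    ∃ G : ℝ → ℂ, Continuous G ∧ G =ᵐ[volume] radon p fun x => χ x * g x := by
  let X : 𝓢(Plane, ℂ) := hχs.toSchwartzMap hχ
  have hX : ∀ x, X x = χ x := fun x => rfl
  have hprod : Integrable fun x => χ x * g x := by
    obtain ⟨B, hB⟩ := hχs.exists_bound_of_continuous hχ.continuous
    exact hg.bdd_mul hχ.continuous.aestronglyMeasurable (ae_of_all _ hB)
  -- The transform of a product is a convolution; `𝓕⁻ X` at η - ξ is `𝓕 X` at ξ - η.
  have key : ∀ ξ : Plane, 𝓕 (fun x => χ x * g x) ξ =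
      ∫ η, 𝓕 g η * (𝓕⁻ X : 𝓢(Plane, ℂ)) (η - ξ) := by
    intro ξ
    have e0 : ∀ x, 𝓕 (fun η => (𝓕⁻ X : 𝓢(Plane, ℂ)) (η - ξ)) x =
        𝐞 (-inner ℝ x ξ) • χ x := by
      intro x
      have h1 : 𝓕 ((𝓕⁻ X : 𝓢(Plane, ℂ)) : Plane → ℂ) x = χ x := by
        rw [← SchwartzMap.fourier_coe, fourier_fourierInv_eq, hX]
      rw [← h1, Real.fourier_eq, Real.fourier_eq, ← integral_add_right_eq_self _ ξ,
        Circle.smul_def, ← integral_smul]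
      refine integral_congr_ae (ae_of_all _ fun η => ?_)
      simp only [add_sub_cancel_right, inner_add_left, neg_add, AddChar.map_add_eq_mul,
        Circle.smul_def, smul_smul, Circle.coe_mul, real_inner_comm x ξ]
      ring_nf
    rw [integral_fourier_mul hg ((𝓕⁻ X).integrable.comp_sub_right ξ), Real.fourier_eq]
    refine integral_congr_ae (ae_of_all _ fun x => ?_)
    simp only [e0, Circle.smul_def, smul_eq_mul]
    ring
  have hF : Integrable (𝓕 (radon p fun x => χ x * g x)) := by
    have := integrable_line_of_memLp hp hr (continuous_fourier hg) hgw (𝓕⁻ X)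
    refine this.congr (ae_of_all _ fun σ => ?_)
    simp only [fourier_radon hp hprod, key]
  refine ⟨𝓕⁻ (𝓕 (radon p fun x => χ x * g x)), ?_,
    fourierInv_fourier_ae_eq (integrable_radon hp hprod) hF⟩
  rw [Real.fourierInv_eq_fourier_comp_neg]
  exact continuous_fourier hF.comp_neg

/-! ### Compact supports and locally finite series of shifts. -/

lemma isCompact_rect (a b : Fin 2 → ℝ) : IsCompact (rect a b) := by
  have h : rect a b = (EuclideanSpace.equiv (Fin 2) ℝ).symm '' Set.Icc a b := by
    ext x
    simp only [rect, Set.mem_ofPred_eq, Set.mem_image, Set.mem_Icc, Pi.le_def]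
    constructor
    · intro h
      exact ⟨EuclideanSpace.equiv (Fin 2) ℝ x, ⟨fun i => (h i).1, fun i => (h i).2⟩, by simp⟩
    · rintro ⟨y, ⟨h1, h2⟩, rfl⟩ i
      exact ⟨h1 i, h2 i⟩
  rw [h]
  exact isCompact_Icc.image (EuclideanSpace.equiv (Fin 2) ℝ).symm.continuous

lemma ae_eq_indicator {f : L2Plane} {a b : Fin 2 → ℝ} (hf : SuppIn f (rect a b)) :
    f =ᵐ[volume] (rect a b).indicator f := by
  filter_upwards [hf] with x hx
  by_cases h : x ∈ rect a b
  · rw [Set.indicator_of_mem h]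
  · rw [Set.indicator_of_notMem h, hx h]

lemma integrable_indicator_rect (f : L2Plane) (a b : Fin 2 → ℝ) :
    Integrable ((rect a b).indicator f) := by
  have hc := isCompact_rect a b
  rw [integrable_indicator_iff hc.measurableSet]
  have : IsFiniteMeasure (volume.restrict (rect a b)) :=
    ⟨by rw [Measure.restrict_apply_univ]; exact hc.measure_lt_top⟩
  exact ((Lp.memLp f).restrict (rect a b)).integrable one_le_two

lemma integrable_of_suppIn {f : L2Plane} {a b : Fin 2 → ℝ} (hf : SuppIn f (rect a b)) :
    Integrable (f : Plane → ℂ) :=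
  (integrable_indicator_rect f a b).congr (ae_eq_indicator hf).symm

/-- The pointwise (locally finite) series `∑ c k u(x - k)`. -/
noncomputable def shiftSeries (c : (Fin 2 → ℤ) → ℂ) (u : Plane → ℂ) (x : Plane) : ℂ :=
  ∑ᶠ k, c k * u (x - latticePt k)

/-- This is where E comes from: it contains every k for which the support box shifted by k meets the
target rectangle. -/
lemma mem_indexSet_of_mem {a b N M : Fin 2 → ℝ} {x : Plane} {k : Fin 2 → ℤ}
    (h1 : x ∈ rect a b) (h2 : x - latticePt k ∈ rect N M) : k ∈ indexSet a b N M := by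
  rw [indexSet, Finset.mem_Icc, Pi.le_def, Pi.le_def]
  refine ⟨fun i => Int.ceil_le.2 ?_, fun i => Int.le_floor.2 ?_⟩
  · have := (h1 i).1; have h3 := (h2 i).2
    simp only [PiLp.sub_apply, latticePt_apply] at h3
    linarith
  · have := (h1 i).2; have h3 := (h2 i).1
    simp only [PiLp.sub_apply, latticePt_apply] at h3
    linarith

lemma finite_shift_mem (N M : Fin 2 → ℝ) (x : Plane) :
    {k | x - latticePt k ∈ rect N M}.Finite :=
  (indexSet x x N M).finite_toSet.subset fun _ hk =>
    mem_indexSet_of_mem (fun _ => ⟨le_rfl, le_rfl⟩) hk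

lemma finite_shift_ne_zero {u : Plane → ℂ} {N M : Fin 2 → ℝ} (hu : ∀ x, x ∉ rect N M → u x = 0)
    (x : Plane) : {k | u (x - latticePt k) ≠ 0}.Finite :=
  (finite_shift_mem N M x).subset fun _ hk => by_contra fun h => hk (hu _ h)

lemma shiftSeries_eq_sum {u : Plane → ℂ} {N M : Fin 2 → ℝ} (hu : ∀ x, x ∉ rect N M → u x = 0)
    (c : (Fin 2 → ℤ) → ℂ) {a b : Fin 2 → ℝ} {x : Plane}
    (hx : x ∈ rect a b) :
    shiftSeries c u x = ∑ k ∈ indexSet a b N M, c k * u (x - latticePt k) := by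
  refine finsum_eq_sum_of_support_subset _ fun k hk => ?_
  exact mem_indexSet_of_mem hx (by_contra fun h => hk (by simp [hu _ h]))

/-- Both sides are the convolution of `c` with two samplings of `u` on cosets of the lattice. -/
lemma finsum_mul_shiftSeries {u : Plane → ℂ} {N M : Fin 2 → ℝ} (hu : ∀ x, x ∉ rect N M → u x = 0)
    (c : (Fin 2 → ℤ) → ℂ) (x y : Plane) :
    ∑ᶠ k, u (x + latticePt k) * shiftSeries c u (y - latticePt k) =
      ∑ᶠ k, shiftSeries c u (x + latticePt k) * u (y - latticePt k) := by
  -- Summing over the second index first gives the left side. Substituting m = k + l and summing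
  -- over l for fixed m gives the right side.
  let T : (Fin 2 → ℤ) × (Fin 2 → ℤ) → ℂ := fun q =>
    u (x + latticePt q.1) * (c q.2 * u (y - latticePt q.1 - latticePt q.2))
  have hA : {k | u (x + latticePt k) ≠ 0}.Finite := by
    have h := (finite_shift_ne_zero hu x).preimage (f := fun k => -k) neg_injective.injOn
    simpa [latticePt_neg] using h
  have hT : T.support.Finite := by
    have hinj : Function.Injective
        fun q : (Fin 2 → ℤ) × (Fin 2 → ℤ) => (q.1, q.1 + q.2) := by
      rintro ⟨k, l⟩ ⟨k', l'⟩ h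
      simp only [Prod.mk.injEq] at h ⊢
      obtain ⟨rfl, h⟩ := h
      exact ⟨rfl, add_left_cancel h⟩
    refine ((hA.prod (finite_shift_ne_zero hu y)).preimage hinj.injOn).subset ?_
    rintro ⟨k, l⟩ hkl
    have h1 : u (x + latticePt k) ≠ 0 := left_ne_zero_of_mul hkl
    have h2 : u (y - latticePt k - latticePt l) ≠ 0 :=
      right_ne_zero_of_mul (right_ne_zero_of_mul hkl)
    refine ⟨h1, ?_⟩
    simp only [Set.mem_ofPred_eq, latticePt_add]
    rwa [← sub_sub]
  let e : (Fin 2 → ℤ) × (Fin 2 → ℤ) ≃ (Fin 2 → ℤ) × (Fin 2 → ℤ) :=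
    { toFun := fun q => (q.1 - q.2, q.2)
      invFun := fun q => (q.1 + q.2, q.2)
      left_inv := fun q => by simp
      right_inv := fun q => by simp }
  have hTe : (fun q => T (e q)).support.Finite := hT.preimage e.injective.injOn
  have h1 : ∑ᶠ q, T q = ∑ᶠ k, u (x + latticePt k) * shiftSeries c u (y - latticePt k) := by
    rw [finsum_curry T hT]
    refine finsum_congr fun k => ?_
    rw [shiftSeries, mul_finsum]
  have h2 : ∑ᶠ q, T (e q) = ∑ᶠ k, shiftSeries c u (x + latticePt k) * u (y - latticePt k) := by
    rw [finsum_curry _ hTe]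
    refine finsum_congr fun m => ?_
    rw [shiftSeries, finsum_mul]
    refine finsum_congr fun l => ?_
    have e1 : x + latticePt (m - l) = x + latticePt m - latticePt l := by
      rw [sub_eq_add_neg, latticePt_add, latticePt_neg]; abel
    have e2 : y - latticePt (m - l) - latticePt l = y - latticePt m := by
      rw [sub_eq_add_neg m, latticePt_add, latticePt_neg]; abel
    simp only [T, e, Equiv.coe_fn_mk, e1, e2]
    ring
  rw [← h1, ← h2, finsum_comp_equiv e]

/-- An `L²`-convergent series of shifts of `φ` is almost everywhere its pointwise sum. -/
lemma ae_eq_shiftSeries {φ f : L2Plane} {N M : Fin 2 → ℝ} (hφ : SuppIn φ (rect N M))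
    {c : (Fin 2 → ℤ) → ℂ} (hf : HasSum (fun k => c k • shift φ k) f) :
    f =ᵐ[volume] shiftSeries c ((rect N M).indicator φ) := by
  set u := (rect N M).indicator φ with hudef
  have hu : ∀ x, x ∉ rect N M → u x = 0 := fun x hx => Set.indicator_of_notMem hx _
  have hshift : ∀ k, ∀ᵐ x : Plane, (shift φ k) x = u (x - latticePt k) := by
    intro k
    have hm := measurePreserving_sub_right (volume : Measure Plane) (latticePt k)
    filter_upwards [Lp.coeFn_compMeasurePreserving φ hm,
      hm.quasiMeasurePreserving.ae (ae_eq_indicator hφ)] with x h1 h2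
    exact h1.trans h2
  have hpart : ∀ F : Finset (Fin 2 → ℤ), ∀ᵐ x : Plane,
      (∑ k ∈ F, c k • shift φ k : L2Plane) x = ∑ k ∈ F, c k * u (x - latticePt k) := by
    intro F
    have h3 : ∀ᵐ x : Plane, ∀ k, (c k • shift φ k : L2Plane) x = c k * u (x - latticePt k) := by
      rw [ae_all_iff]
      intro k
      filter_upwards [Lp.coeFn_smul (c k) (shift φ k), hshift k] with x h1 h2
      rw [h1, Pi.smul_apply, h2, smul_eq_mul]
    filter_upwards [Lp.coeFn_finsetSum F (fun k => c k • shift φ k), h3] with x h1 h2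
    rw [h1, Finset.sum_apply]
    exact Finset.sum_congr rfl fun k _ => h2 k
  -- Convergence in L² gives almost everywhere convergence along a sequence of finite partial sums.
  -- At each point these are eventually constant by local finiteness.
  obtain ⟨ns, hns, hlim⟩ := (tendstoInMeasure_of_tendsto_Lp hf).exists_seq_tendsto_ae'
  filter_upwards [hlim, ae_all_iff.2 hpart] with x h1 h2
  have hfin : (Function.support fun k => c k * u (x - latticePt k)).Finite :=
    (finite_shift_ne_zero hu x).subset fun k hk => right_ne_zero_of_mul hk
  refine tendsto_nhds_unique h1 (tendsto_const_nhds.congr' ?_)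
  filter_upwards [hns.eventually_ge_atTop hfin.toFinset] with i hi
  rw [h2, shiftSeries]
  refine finsum_eq_sum_of_support_subset _ fun k hk => ?_
  exact hi (hfin.mem_toFinset.2 hk)

/-! ### Exponential sums and uniqueness from one line. -/

/-- The Fourier transform of a finite combination of shifts. -/
lemma fourier_sum_shift {h : Plane → ℂ} (hh : Integrable h) (A : Finset (Fin 2 → ℤ))
    (d : (Fin 2 → ℤ) → ℂ) (ξ : Plane) :
    𝓕 (fun y => ∑ k ∈ A, d k * h (y - latticePt k)) ξ =
      (∑ k ∈ A, d k * 𝐞 (-inner ℝ (latticePt k) ξ)) * 𝓕 h ξ := by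
  have hI : ∀ k ∈ A, Integrable fun y : Plane =>
      𝐞 (-inner ℝ y ξ) • (d k * h (y - latticePt k)) := fun k _ =>
    (Real.fourierIntegral_convergent_iff ξ).2 ((hh.comp_sub_right (latticePt k)).const_mul _)
  rw [Real.fourier_eq]
  simp only [Finset.smul_sum]
  rw [integral_finsetSum _ hI, Finset.sum_mul]
  refine Finset.sum_congr rfl fun k _ => ?_
  rw [← integral_add_right_eq_self _ (latticePt k), Real.fourier_eq, ← integral_const_mul]
  refine integral_congr_ae (ae_of_all _ fun y => ?_)
  simp only [add_sub_cancel_right, inner_add_left, neg_add, AddChar.map_add_eq_mul,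
    Circle.smul_def, smul_eq_mul, Circle.coe_mul]
  ring

/-- An exponential sum with distinct frequencies that vanishes near `0` has zero coefficients. -/
lemma eq_zero_of_sum_fourierChar {ι : Type*} (E : Finset ι) (d : ι → ℂ) (τ : ι → ℝ)
    (hτ : Set.InjOn τ E) {δ : ℝ} (hδ : 0 < δ)
    (h : ∀ σ : ℝ, 0 ≤ σ → σ < δ → ∑ k ∈ E, d k * 𝐞 (-(σ * τ k)) = 0) : ∀ k ∈ E, d k = 0 := by
  set n := E.card with hn
  set T := ∑ k ∈ E, |τ k| with hT
  have hT0 : 0 ≤ T := Finset.sum_nonneg fun k _ => abs_nonneg _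
  -- The points jε with j < n must stay in [0, δ), and the angles 2πε τ_k in (-π, π), so that the
  -- nodes exp(-2πiε τ_k) are distinct. Sampling at these points gives a Vandermonde system.
  obtain ⟨ε, hε0, hε1, hε2⟩ : ∃ ε : ℝ, 0 < ε ∧ ε * n < δ ∧ ε * T < 1 / 2 := by
    refine ⟨min (δ / (n + 1)) (1 / (2 * (T + 1))), by positivity, ?_, ?_⟩
    · calc _ ≤ δ / (n + 1) * n := by gcongr; exact min_le_left _ _
        _ < δ := by rw [div_mul_eq_mul_div, div_lt_iff₀ (by positivity)]; nlinarith
    · calc _ ≤ 1 / (2 * (T + 1)) * T := by gcongr; exact min_le_right _ _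
        _ < 1 / 2 := by rw [div_mul_eq_mul_div, div_lt_iff₀ (by positivity)]; linarith
  have hsmall : ∀ k ∈ E, |ε * τ k| < 1 / 2 := fun k hk => by
    rw [abs_mul, abs_of_pos hε0]
    refine lt_of_le_of_lt ?_ hε2
    gcongr
    exact Finset.single_le_sum (f := fun k => |τ k|) (fun k _ => abs_nonneg _) hk
  let e := E.equivFin.symm
  have hinj : Function.Injective fun i : Fin n => ((𝐞 (-(ε * τ (e i))) : Circle) : ℂ) := by
    intro i j hij
    simp only [Real.fourierChar_apply] at hij
    have hi := abs_lt.1 (hsmall _ (e i).2)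
    have hj := abs_lt.1 (hsmall _ (e j).2)
    have hpi := Real.pi_pos
    have h1 := Complex.exp_inj_of_neg_pi_lt_of_le_pi (by simp; nlinarith) (by simp; nlinarith)
      (by simp; nlinarith) (by simp; nlinarith) hij
    have h2 : τ (e i) = τ (e j) := by
      have h3 := congrArg Complex.im h1
      simp at h3
      rcases h3 with h3 | h3
      · exact h3
      · exact absurd h3 hε0.ne'
    exact e.injective (Subtype.ext (hτ (e i).2 (e j).2 h2))
  have hv := Matrix.eq_zero_of_forall_pow_sum_mul_pow_eq_zero (v := fun i : Fin n => d (e i)) hinj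
    (fun j => by
      have h1 := h (ε * j) (by positivity) (lt_of_le_of_lt (by gcongr; exact j.2.le) hε1)
      rw [← Finset.sum_coe_sort, ← e.sum_comp] at h1
      rw [← h1]
      refine Finset.sum_congr rfl fun i _ => ?_
      congr 1
      rw [← Circle.coe_pow, ← AddChar.map_nsmul_eq_pow]
      congr 2
      simp; ring)
  intro k hk
  have := congrFun hv (e.symm ⟨k, hk⟩)
  simpa using this

/-- If the Fourier transform of a compactly supported member of the shift-invariant space vanishes
on a line whose direction separates the points of `E`, then the function vanishes. -/
lemma shiftSeries_ae_eq_zero {u : Plane → ℂ} {N M a b : Fin 2 → ℝ}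
    (hu : ∀ x, x ∉ rect N M → u x = 0) (hui : Integrable u) (hu0 : 𝓕 u 0 ≠ 0)
    {c : (Fin 2 → ℤ) → ℂ} (hf : Integrable (shiftSeries c u))
    (hsupp : ∀ᵐ x : Plane, x ∉ rect a b → shiftSeries c u x = 0) {p : Plane}
    (hp : Set.InjOn (fun k => inner ℝ (latticePt k) p) (indexSet a b N M))
    (hzero : ∀ σ : ℝ, 𝓕 (shiftSeries c u) (σ • p) = 0) :
    shiftSeries c u =ᵐ[volume] 0 := by
  set E := indexSet a b N M
  obtain ⟨δ, hδ, hne⟩ : ∃ δ > 0, ∀ σ : ℝ, 0 ≤ σ → σ < δ → 𝓕 u (σ • p) ≠ 0 := by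
    have hc : Continuous fun σ : ℝ => 𝓕 u (σ • p) :=
      (continuous_fourier hui).comp (by fun_prop)
    have h0 : ∀ᶠ σ in 𝓝 (0 : ℝ), 𝓕 u (σ • p) ≠ 0 :=
      hc.continuousAt.eventually_ne (by simpa using hu0)
    obtain ⟨δ, hδ, h⟩ := Metric.eventually_nhds_iff.1 h0
    exact ⟨δ, hδ, fun σ h1 h2 => h (by rwa [Real.dist_eq, sub_zero, abs_of_nonneg h1])⟩
  have main : ∀ x : Plane, x ∈ rect N M →
      (∀ k, x + latticePt k ∉ rect a b → shiftSeries c u (x + latticePt k) = 0) →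
      ∀ k, shiftSeries c u (x + latticePt k) = 0 := by
    intro x hx hgood
    have hE : ∀ k, k ∉ E → shiftSeries c u (x + latticePt k) = 0 := fun k hk =>
      hgood k fun h => hk (mem_indexSet_of_mem h (by rwa [add_sub_cancel_right]))
    have hA : {k | u (x + latticePt k) ≠ 0}.Finite := by
      have h := (finite_shift_ne_zero hu x).preimage (f := fun k => -k) neg_injective.injOn
      simpa [latticePt_neg] using h
    -- Both sums become finite: on the left `u` has compact support, on the right the samples vanish
    -- off `E`.
    have hid : (fun y => ∑ k ∈ hA.toFinset,
        u (x + latticePt k) * shiftSeries c u (y - latticePt k)) =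
        fun y => ∑ k ∈ E, shiftSeries c u (x + latticePt k) * u (y - latticePt k) := by
      funext y
      rw [← finsum_eq_sum_of_support_subset, ← finsum_eq_sum_of_support_subset,
        finsum_mul_shiftSeries hu]
      · exact fun k hk => by_contra fun h => hk (by simp [hE k h])
      · exact fun k hk => hA.mem_toFinset.2 (left_ne_zero_of_mul hk)
    have hsum : ∀ σ : ℝ, 0 ≤ σ → σ < δ → ∑ k ∈ E, shiftSeries c u (x + latticePt k) *
        𝐞 (-(σ * inner ℝ (latticePt k) p)) = 0 := by
      intro σ h1 h2
      have h3 := congrArg (fun g : Plane → ℂ => (𝓕 g : Plane → ℂ) (σ • p)) hid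
      simp only [fourier_sum_shift hf, fourier_sum_shift hui, hzero, mul_zero,
        inner_smul_right] at h3
      exact (mul_eq_zero.1 h3.symm).resolve_right (hne σ h1 h2)
    intro k
    by_cases hk : k ∈ E
    · exact eq_zero_of_sum_fourierChar E (fun k => shiftSeries c u (x + latticePt k)) _ hp hδ
        hsum k hk
    · exact hE k hk
  -- Countability of the lattice makes the support condition hold on the whole coset of almost every
  -- x.
  have hall : ∀ᵐ x : Plane, ∀ k,
      x + latticePt k ∉ rect a b → shiftSeries c u (x + latticePt k) = 0 := by
    rw [ae_all_iff]
    intro k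
    exact (measurePreserving_add_right (volume : Measure Plane)
      (latticePt k)).quasiMeasurePreserving.ae hsupp
  filter_upwards [hall] with x hx
  by_contra hne0
  -- A nonzero value at x forces some x - k into the support box, and `main` applies to the coset
  -- based there.
  obtain ⟨k, hk⟩ : ∃ k, c k * u (x - latticePt k) ≠ 0 := by
    by_contra! hk
    exact hne0 (by simp [shiftSeries, hk])
  have hmem : x - latticePt k ∈ rect N M :=
    by_contra fun h => right_ne_zero_of_mul hk (hu _ h)
  refine hne0 ?_
  have := main (x - latticePt k) hmem (fun l hl => ?_) k
  · simpa using this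
  · have e : x - latticePt k + latticePt l = x + latticePt (l - k) := by
      rw [sub_eq_add_neg l, latticePt_add, latticePt_neg]; abel
    rw [e] at hl ⊢
    exact hx _ hl

/-! ### Dimension count. -/

/-- Finitely many functionals, at most as many as the dimension, suffice to separate the points of
a finite-dimensional space that is separated by a family of functionals. -/
lemma exists_finset_separating {V ι : Type*} [AddCommGroup V] [Module ℂ V]
    (ev : ι → V →ₗ[ℂ] ℂ) (n : ℕ) : ∀ U : Submodule ℂ V, FiniteDimensional ℂ U →
    Module.finrank ℂ U ≤ n → (∀ f ∈ U, (∀ i, ev i f = 0) → f = 0) →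
    ∃ X : Finset ι, X.card ≤ n ∧ ∀ f ∈ U, (∀ i ∈ X, ev i f = 0) → f = 0 := by
  classical
  induction n with
  | zero =>
    intro U _ hU _
    have h : U = ⊥ := Submodule.finrank_eq_zero.1 (Nat.le_zero.1 hU)
    exact ⟨∅, le_rfl, fun f hf _ => by simpa [h] using hf⟩
  | succ n ih =>
    intro U _ hU hsep
    by_cases hbot : ∀ f ∈ U, f = 0
    · exact ⟨∅, by simp, fun f hf _ => hbot f hf⟩
    push Not at hbot
    obtain ⟨f, hf, hf0⟩ := hbot
    obtain ⟨i, hi⟩ : ∃ i, ev i f ≠ 0 := by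
      by_contra! h
      exact hf0 (hsep f hf h)
    -- The kernel of a functional not vanishing on `U` has smaller dimension there, so one point is
    -- spent per dimension.
    have hlt : U ⊓ LinearMap.ker (ev i) < U :=
      lt_of_le_of_ne inf_le_left fun h => hi (h.ge hf).2
    have hfin : FiniteDimensional ℂ (U ⊓ LinearMap.ker (ev i) : Submodule ℂ V) :=
      Submodule.finiteDimensional_of_le hlt.le
    obtain ⟨X, hX, hXs⟩ := ih _ hfin
      (by have := Submodule.finrank_lt_finrank_of_lt hlt; omega)
      fun g hg => hsep g hg.1
    refine ⟨insert i X, (Finset.card_insert_le _ _).trans (by omega), fun g hg hgX => ?_⟩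
    exact hXs g ⟨hg, hgX i (Finset.mem_insert_self _ _)⟩
      fun j hj => hgX j (Finset.mem_insert_of_mem hj)

/-- The target class is a linear subspace. -/
noncomputable def targetSpace (φ : L2Plane) (a b : Fin 2 → ℝ) : Submodule ℂ L2Plane where
  carrier := targets φ a b
  zero_mem' := by
    refine ⟨⟨0, by simp, by simp⟩, ?_⟩
    filter_upwards [Lp.coeFn_zero ℂ 2 (volume : Measure Plane)] with x hx _
    rw [hx]; rfl
  add_mem' := by
    rintro f g ⟨⟨c, hc, hcf⟩, hf⟩ ⟨⟨d, hd, hdg⟩, hg⟩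
    refine ⟨⟨c + d, ?_, by simpa [add_smul] using hcf.add hdg⟩, ?_⟩
    · refine Summable.of_nonneg_of_le (fun k => by positivity) (fun k => ?_)
        ((hc.add hd).mul_left 2)
      have h := norm_add_le (c k) (d k)
      calc ‖(c + d) k‖ ^ 2 ≤ (‖c k‖ + ‖d k‖) ^ 2 := by gcongr; exact h
        _ ≤ 2 * (‖c k‖ ^ 2 + ‖d k‖ ^ 2) := add_sq_le
    · filter_upwards [Lp.coeFn_add f g, hf, hg] with x h1 h2 h3 hx
      rw [h1, Pi.add_apply, h2 hx, h3 hx, add_zero]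
  smul_mem' := by
    rintro z f ⟨⟨c, hc, hcf⟩, hf⟩
    refine ⟨⟨fun k => z * c k, ?_, by simpa [mul_smul] using hcf.const_smul z⟩, ?_⟩
    · simpa [mul_pow] using hc.mul_left (‖z‖ ^ 2)
    · filter_upwards [Lp.coeFn_smul z f, hf] with x h1 h2 hx
      rw [h1, Pi.smul_apply, h2 hx, smul_zero]

/-- Only shifts indexed by E can be nonzero on the rectangle, so the restrictions of these shifts to
the rectangle span. Restriction is needed since a single shift may stick out. -/
lemma targetSpace_finite_finrank_le {φ : L2Plane} {N M : Fin 2 → ℝ} (a b : Fin 2 → ℝ)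
    (hφ : SuppIn φ (rect N M)) : FiniteDimensional ℂ (targetSpace φ a b) ∧
      Module.finrank ℂ (targetSpace φ a b) ≤ (indexSet a b N M).card := by
  classical
  set E := indexSet a b N M
  let h : (Fin 2 → ℤ) → L2Plane := fun k =>
    ((Lp.memLp (shift φ k)).indicator (isCompact_rect a b).measurableSet).toLp _
  let S : Submodule ℂ L2Plane := Submodule.span ℂ (E.image h : Set L2Plane)
  have hS : Module.finrank ℂ S ≤ E.card :=
    (finrank_span_finset_le_card _).trans Finset.card_image_le
  have hSfin : FiniteDimensional ℂ S := FiniteDimensional.span_finset ℂ _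
  have hle : targetSpace φ a b ≤ S := by
    rintro f ⟨⟨c, -, hcf⟩, hf⟩
    have hfe : f = ∑ k ∈ E, c k • h k := by
      have hu : ∀ x, x ∉ rect N M → (rect N M).indicator φ x = 0 :=
        fun x hx => Set.indicator_of_notMem hx _
      have h1 : ∀ k, ∀ᵐ x : Plane, (c k • h k : L2Plane) x =
          (rect a b).indicator (fun x => c k * (rect N M).indicator φ (x - latticePt k)) x := by
        intro k
        have hm := measurePreserving_sub_right (volume : Measure Plane) (latticePt k)
        filter_upwards [Lp.coeFn_smul (c k) (h k),
          ((Lp.memLp (shift φ k)).indicator (isCompact_rect a b).measurableSet).coeFn_toLp,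
          Lp.coeFn_compMeasurePreserving φ hm,
          hm.quasiMeasurePreserving.ae (ae_eq_indicator hφ)] with x e1 e2 e3 e4
        rw [e1, Pi.smul_apply, e2]
        by_cases hx : x ∈ rect a b
        · rw [Set.indicator_of_mem hx, Set.indicator_of_mem hx, smul_eq_mul]
          exact congrArg _ (e3.trans e4)
        · rw [Set.indicator_of_notMem hx, Set.indicator_of_notMem hx, smul_zero]
      refine Lp.ext ?_
      filter_upwards [hf, ae_eq_shiftSeries hφ hcf, ae_all_iff.2 h1,
        Lp.coeFn_finsetSum E (fun k => c k • h k)] with x e1 e2 e3 e4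
      rw [e4, Finset.sum_apply]
      by_cases hx : x ∈ rect a b
      · rw [e2, shiftSeries_eq_sum hu c hx]
        exact Finset.sum_congr rfl fun k _ => by rw [e3, Set.indicator_of_mem hx]
      · rw [e1 hx]
        exact (Finset.sum_eq_zero fun k _ => by rw [e3, Set.indicator_of_notMem hx]).symm
    rw [hfe]
    exact Submodule.sum_mem _ fun k hk => Submodule.smul_mem _ _
      (Submodule.subset_span (by simpa using ⟨k, hk, rfl⟩))
  exact ⟨Submodule.finiteDimensional_of_le hle, (Submodule.finrank_mono hle).trans hS⟩

/-! ### Radon transforms of the targets. -/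

/-- Radon transforms of the targets have continuous versions. -/
lemma exists_isRadonTransform {φ : L2Plane} {N M a b : Fin 2 → ℝ} (hφ : SuppIn φ (rect N M))
    (hsmooth : ((1 / 2 : ℝ) : EReal) < sobolevSmoothness φ) {p : Plane}
    (hp : p 0 ^ 2 + p 1 ^ 2 = 1) {f : L2Plane} (hf : f ∈ targets φ a b) :
    ∃ g, IsRadonTransform p f g := by
  obtain ⟨⟨c, -, hcf⟩, hfs⟩ := hf
  obtain ⟨_, ⟨r, rfl, hr⟩, hlt⟩ := lt_sSup_iff.1 hsmooth
  have hr2 : (1 / 2 : ℝ) < r := EReal.coe_lt_coe_iff.1 hlt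
  set u := (rect N M).indicator φ
  have hu : ∀ x, x ∉ rect N M → u x = 0 := fun x hx => Set.indicator_of_notMem hx _
  have hui : Integrable u := integrable_indicator_rect φ N M
  have hw := memLp_weight_fourier hr (integrable_of_suppIn hφ)
  obtain ⟨R, hR0, hR⟩ := (isCompact_rect a b).isBounded.subset_closedBall_lt 0 (0 : Plane)
  let B : ContDiffBump (0 : Plane) := ⟨R, R + 1, hR0, lt_add_one R⟩
  let χ : Plane → ℂ := fun x => (B x : ℂ)
  have hχ : ContDiff ℝ ∞ χ := Complex.ofRealCLM.contDiff.comp B.contDiff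
  have hχs : HasCompactSupport χ := B.hasCompactSupport.comp_left Complex.ofReal_zero
  -- The series for f may be infinite. Keeping the shifts that can reach the support of `χ` gives a
  -- finite sum `g` with f = χ g almost everywhere; its transform is a bounded trigonometric
  -- polynomial times that of `u`, so it inherits the weighted bound.
  let E := indexSet (fun _ => -(R + 1)) (fun _ => R + 1) N M
  let g : Plane → ℂ := fun x => ∑ k ∈ E, c k * u (x - latticePt k)
  have hgi : Integrable g :=
    integrable_finsetSum _ fun k _ => (hui.comp_sub_right (latticePt k)).const_mul _
  have hgw : MemLp (fun ξ : Plane => (((1 + ‖ξ‖ ^ 2) ^ (r / 2) : ℝ) : ℂ) * 𝓕 g ξ) 2 := by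
    have hwc : Continuous fun ξ : Plane => (((1 + ‖ξ‖ ^ 2) ^ (r / 2) : ℝ) : ℂ) :=
      Complex.continuous_ofReal.comp ((by fun_prop : Continuous fun ξ : Plane =>
        1 + ‖ξ‖ ^ 2).rpow_const fun ξ => Or.inl (by positivity))
    refine hw.of_le_mul (c := ∑ k ∈ E, ‖c k‖)
      (hwc.mul (continuous_fourier hgi)).aestronglyMeasurable (ae_of_all _ fun ξ => ?_)
    have e1 : 𝓕 g ξ = _ := fourier_sum_shift hui E c ξ
    have e2 : 𝓕 u ξ = 𝓕 (φ : Plane → ℂ) ξ := Real.fourier_congr_ae (ae_eq_indicator hφ).symm ξ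
    rw [e1, e2, norm_mul, norm_mul, norm_mul, mul_left_comm]
    refine mul_le_mul_of_nonneg_right ((norm_sum_le _ _).trans
      (Finset.sum_le_sum fun k _ => ?_)) (by positivity)
    rw [norm_mul, Circle.norm_coe, mul_one]
  obtain ⟨G, hGc, hG⟩ := exists_continuous_radon hp hr2 hgi hgw hχ hχs
  refine ⟨G, hGc, hG.trans (radon_congr_ae hp ?_)⟩
  filter_upwards [ae_eq_shiftSeries hφ hcf, hfs] with x h1 h2
  by_cases hx : x ∈ Metric.ball (0 : Plane) (R + 1)
  · have hmem : x ∈ rect (fun _ => -(R + 1)) (fun _ => R + 1) := by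
      intro i
      have h3 := (PiLp.norm_apply_le x i).trans_lt (mem_ball_zero_iff.1 hx)
      rw [Real.norm_eq_abs, abs_lt] at h3
      exact ⟨h3.1.le, h3.2.le⟩
    have e1 : g x = f x := by rw [h1, shiftSeries_eq_sum hu c hmem]
    rw [e1]
    by_cases hxr : x ∈ rect a b
    · simp [χ, B.one_of_mem_closedBall (hR hxr)]
    · rw [h2 hxr, mul_zero]
  · have hxr : x ∉ rect a b := fun h => hx
      (Metric.closedBall_subset_ball (lt_add_one R) (hR h))
    have hB : B x = 0 := B.zero_of_le_dist (by simpa using hx)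
    simp [χ, hB, h2 hxr]

lemma IsRadonTransform.unique {p : Plane} {f : L2Plane} {g₁ g₂ : ℝ → ℂ}
    (h₁ : IsRadonTransform p f g₁) (h₂ : IsRadonTransform p f g₂) : g₁ = g₂ :=
  (h₁.1.ae_eq_iff_eq volume h₂.1).1 (h₁.2.trans h₂.2.symm)

lemma IsRadonTransform.add {p : Plane} (hp : p 0 ^ 2 + p 1 ^ 2 = 1) {f₁ f₂ : L2Plane}
    (hf₁ : Integrable (f₁ : Plane → ℂ)) (hf₂ : Integrable (f₂ : Plane → ℂ)) {g₁ g₂ : ℝ → ℂ}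
    (h₁ : IsRadonTransform p f₁ g₁) (h₂ : IsRadonTransform p f₂ g₂) :
    IsRadonTransform p (f₁ + f₂ : L2Plane) (g₁ + g₂) :=
  ⟨h₁.1.add h₂.1, ((h₁.2.add h₂.2).trans (radon_add hp hf₁ hf₂).symm).trans
    (radon_congr_ae hp (Lp.coeFn_add f₁ f₂).symm)⟩

lemma IsRadonTransform.smul {p : Plane} (hp : p 0 ^ 2 + p 1 ^ 2 = 1) {f : L2Plane} {g : ℝ → ℂ}
    (c : ℂ) (h : IsRadonTransform p f g) : IsRadonTransform p (c • f : L2Plane) (c • g) := by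
  refine ⟨h.1.const_smul c, ?_⟩
  refine EventuallyEq.trans ?_ (radon_congr_ae hp (Lp.coeFn_smul c f).symm)
  filter_upwards [h.2] with t ht
  rw [Pi.smul_apply, ht]
  exact (radon_const_mul p c f t).symm

/-- In a direction that separates the points of `E`, a target is determined by its Radon
transform. -/
lemma eq_zero_of_isRadonTransform_zero {φ : L2Plane} {N M a b : Fin 2 → ℝ}
    (hφ : SuppIn φ (rect N M)) (hint : ∫ x, φ x ≠ 0) {p : Plane} (hp : p 0 ^ 2 + p 1 ^ 2 = 1)
    (hinj : Set.InjOn (fun k => inner ℝ (latticePt k) p) (indexSet a b N M))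
    {f : L2Plane} (hf : f ∈ targets φ a b) (h0 : IsRadonTransform p f 0) : f = 0 := by
  obtain ⟨⟨c, -, hcf⟩, hfs⟩ := hf
  have hfe := ae_eq_shiftSeries hφ hcf
  have hfi := integrable_of_suppIn hfs
  have hzero : shiftSeries c ((rect N M).indicator φ) =ᵐ[volume] 0 := by
    refine shiftSeries_ae_eq_zero (a := a) (b := b)
      (fun x hx => Set.indicator_of_notMem hx _)
      (integrable_indicator_rect φ N M) ?_ (hfi.congr hfe) ?_ hinj fun σ => ?_
    · rw [Real.fourier_congr_ae (ae_eq_indicator hφ).symm, Real.fourier_eq]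
      simpa using hint
    · filter_upwards [hfe, hfs] with x h1 h2 hx
      rw [← h1, h2 hx]
    · rw [← Real.fourier_congr_ae hfe, ← fourier_radon hp hfi,
        Real.fourier_congr_ae h0.2.symm, Real.fourier_eq]
      simp
  exact (Lp.eq_zero_iff_ae_eq_zero).2 (hfe.trans hzero)

end RadonSIS

open RadonSIS in
theorem theorem4p6 (φ : L2Plane) (N M a b : Fin 2 → ℝ)
    (hsupp : SuppIn φ (rect N M))
    (hindep : LinearIndependent ℂ (shift φ))
    (hsmooth : ((1 / 2 : ℝ) : EReal) < sobolevSmoothness φ)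
    (hint : ∫ x, φ x ≠ 0) :
    (dv (nullSet (diffSet (indexSet a b N M)))).Finite ∧
    ∀ p ∈ allDirections \ dv (nullSet (diffSet (indexSet a b N M))),
      (∀ f ∈ targets φ a b, ∃! g : ℝ → ℂ, IsRadonTransform p f g) ∧
      ∃ X : Finset ℝ, X.card = (indexSet a b N M).card ∧
        ∀ f₁ ∈ targets φ a b, ∀ f₂ ∈ targets φ a b,
          ∀ g₁ g₂ : ℝ → ℂ, IsRadonTransform p f₁ g₁ → IsRadonTransform p f₂ g₂ →
            (∀ x ∈ X, g₁ x = g₂ x) → f₁ = f₂ := by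
  refine ⟨finite_dv_nullSet (finite_diffSet _), fun p hp => ?_⟩
  have hp1 := sq_add_sq_of_mem_allDirections hp.1
  have hinj := injOn_inner_of_notMem_dv hp
  have hex : ∀ f : targetSpace φ a b, ∃ g, IsRadonTransform p (f : L2Plane) g :=
    fun f => exists_isRadonTransform hsupp hsmooth hp1 f.2
  have hLi : ∀ f : targetSpace φ a b, Integrable ((f : L2Plane) : Plane → ℂ) :=
    fun f => integrable_of_suppIn f.2.2
  choose T hT using hex
  -- Evaluation is linear because the continuous version is unique.
  let ev : ℝ → targetSpace φ a b →ₗ[ℂ] ℂ := fun t =>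
    { toFun := fun f => T f t
      map_add' := fun f g => congrFun
        ((hT (f + g)).unique ((hT f).add hp1 (hLi f) (hLi g) (hT g))) t
      map_smul' := fun c f => congrFun ((hT (c • f)).unique ((hT f).smul hp1 c)) t }
  refine ⟨fun f hf => ?_, ?_⟩
  · obtain ⟨g, hg⟩ := exists_isRadonTransform hsupp hsmooth hp1 hf
    exact ⟨g, hg, fun g' hg' => hg'.unique hg⟩
  obtain ⟨hfin, hrank⟩ := targetSpace_finite_finrank_le a b hsupp
  obtain ⟨X₀, hX₀, hsep⟩ := exists_finset_separating ev (indexSet a b N M).card ⊤ inferInstance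
    (by rwa [finrank_top]) fun f _ hf => by
      have h0 : T f = 0 := funext hf
      exact Subtype.ext (eq_zero_of_isRadonTransform_zero hsupp hint hp1 hinj f.2 (h0 ▸ hT f))
  -- Extra points do no harm, so the separating set is padded to exactly #E elements.
  obtain ⟨X, hX₀X, hX⟩ := Infinite.exists_superset_card_eq X₀ _ hX₀
  refine ⟨X, hX, fun f₁ hf₁ f₂ hf₂ g₁ g₂ hg₁ hg₂ hg => ?_⟩
  let F₁ : targetSpace φ a b := ⟨f₁, hf₁⟩
  let F₂ : targetSpace φ a b := ⟨f₂, hf₂⟩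
  have h := hsep (F₁ - F₂) trivial fun t ht => by
    rw [map_sub, sub_eq_zero]
    have e₁ : T F₁ = g₁ := (hT F₁).unique hg₁
    have e₂ : T F₂ = g₂ := (hT F₂).unique hg₂
    change T F₁ t = T F₂ t
    rw [e₁, e₂, hg t (hX₀X ht)]
  exact congrArg Subtype.val (sub_eq_zero.1 h)
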